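/- Let $2\le k<n$ be integers, let $K\subset\mathbb{C}^n$ be a convex body (a compact convex set with non-empty interior), and let $p_0\in\mathbb{C}^n$ be an arbitrary point (inside $K$, on its boundary, or outside). For an affine complex subspace $H\subseteq\mathbb{C}^n$ of complex dimension $m$, a complex ellipsoid in $H$ is the image of the closed unit ball $\{z\in\mathbb{C}^m : |z_1|^2+\dots+|z_m|^2\le 1\}$ under a complex affine isomorphism $\mathbb{C}^m\to H$. Suppose that for every affine complex subspace $H$ of complex dimension $k$ that passes through $p_0$ and meets the interior of $K$, the section $H\cap K$ is a complex ellipsoid in $H$. Then $K$ is a complex ellipsoid in $\mathbb{C}^n$. -/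

import Mathlib

/-- `S ⊆ ℂⁿ` is an `m`-dimensional (non-degenerate) complex ellipsoid: the image of the closed unit
ball of `ℂᵐ` (Hermitian norm) under an injective complex affine map `ℂᵐ → ℂⁿ`. For `m = n` such a
map is an invertible affine transformation of `ℂⁿ`. If `S` lies in an affine `m`-plane `H`, the map
is an affine isomorphism of `ℂᵐ` onto `H`, so that `S` is a complex ellipsoid in `H`. -/
def IsComplexEllipsoid {n : ℕ} (m : ℕ) (S : Set (EuclideanSpace ℂ (Fin n))) : Prop :=
  ∃ f : EuclideanSpace ℂ (Fin m) →ᵃ[ℂ] EuclideanSpace ℂ (Fin n),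
    Function.Injective f ∧ S = f '' Metric.closedBall 0 1

/-! Move `p₀` to the origin. Each section by a linear `k`-plane `H` is given by `‖A z‖² - 2 Re l z +
c ≤ 0`, an equation fixed up to a positive factor. Normalize `c` to `-1`, `0` or `1` according to
whether the origin is interior to `K`, on its boundary in `K`, or outside; when `c = 0`, normalize
`l` by a supporting functional of `K`. On a complex line through the origin and an interior point `v
≠ 0`, the set `K` is a disc, which determines `‖A v‖²` and `l v` (`disc_coeffs_unique`). Hence all
planes through `v` give the same values there (`IsHermitianSection.unique`).

Fix an interior point `z₀ ≠ 0`. The planes through `z₀` define functions `q` and `L` on the whole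
space. Near `z₀` these agree with the data of every section, and any two vectors share a `k`-plane,
so `q` is quadratic on segments near `z₀` and `L` is linear.

The crux is that `q` is a Hermitian form. Its second difference `q (v + h) + q (v - h) - 2 q v` is
homogeneous of degree `0` in `v` and quadratic on segments of a ball, hence constant there
(`eq_of_quadratic_on_lines_of_homogeneous`). At `z₀` it equals `2 q h`, which gives the
parallelogram law, and Jordan–von Neumann applies. Since every `z` shares a plane with `z₀`, the
inequality `q z - 2 Re L z + c ≤ 0` describes all of `K`. -/

/-! ### Functions that are quadratic on the segments of a ball -/

theorem quartic_coeffs_eq_zero {p₀ p₁ p₂ p₃ p₄ δ : ℝ} (hδ : 0 < δ)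
    (h : ∀ y : ℝ, |y| < δ → p₀ + p₁ * y + p₂ * y ^ 2 + p₃ * y ^ 3 + p₄ * y ^ 4 = 0) :
    p₀ = 0 ∧ p₁ = 0 ∧ p₂ = 0 ∧ p₃ = 0 ∧ p₄ = 0 := by
  obtain ⟨η, hη, hηδ⟩ : ∃ η : ℝ, 0 < η ∧ 2 * η < δ := ⟨δ / 4, by linarith, by linarith⟩
  have e0 := h 0 (by simpa using hδ)
  have e1 := h η (by rw [abs_lt]; constructor <;> linarith)
  have e2 := h (-η) (by rw [abs_lt]; constructor <;> linarith)
  have e3 := h (2 * η) (by rw [abs_lt]; constructor <;> linarith)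
  have e4 := h (-(2 * η)) (by rw [abs_lt]; constructor <;> linarith)
  ring_nf at e0 e1 e2 e3 e4
  have h1 : p₁ * η = 0 := by linarith
  have h2 : p₂ * η ^ 2 = 0 := by linarith
  have h3 : p₃ * η ^ 3 = 0 := by linarith
  have h4 : p₄ * η ^ 4 = 0 := by linarith
  simp only [mul_eq_zero, pow_eq_zero_iff, hη.ne', or_false, ne_eq, OfNat.ofNat_ne_zero,
    not_false_eq_true] at h1 h2 h3 h4
  exact ⟨e0, h1, h2, h3, h4⟩

/-- A function that is homogeneous of degree `0` and quadratic on the line segments of a ball is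
constant on that ball. -/
theorem eq_of_quadratic_on_lines_of_homogeneous {V : Type*} [NormedAddCommGroup V]
    [NormedSpace ℝ V] {D : V → ℝ} {z₀ : V} {ρ : ℝ}
    (hquad : ∀ v ∈ Metric.ball z₀ ρ, ∀ w : V, ∃ a b c : ℝ, ∀ t : ℝ,
      v + t • w ∈ Metric.ball z₀ ρ → D (v + t • w) = a + b * t + c * t ^ 2)
    (hhom : ∀ v ∈ Metric.ball z₀ ρ, ∀ s : ℝ, s ≠ 0 → s • v ∈ Metric.ball z₀ ρ → D (s • v) = D v)
    {v v' : V} (hv : v ∈ Metric.ball z₀ ρ) (hv' : v' ∈ Metric.ball z₀ ρ) : D v' = D v := by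
  obtain ⟨a, b, c, h1⟩ := hquad v hv (v' - v)
  obtain ⟨a', b', c', h2⟩ := hquad v hv v'
  have ev1 : ∀ᶠ y : ℝ in nhds 0, v + y • v' ∈ Metric.ball z₀ ρ :=
    ContinuousAt.eventually_mem (f := fun y : ℝ => v + y • v') (by fun_prop)
      (Metric.isOpen_ball.mem_nhds (by simpa using hv))
  have ev2 : ∀ᶠ y : ℝ in nhds 0, v + (y / (1 + y)) • (v' - v) ∈ Metric.ball z₀ ρ := by
    refine ContinuousAt.eventually_mem (f := fun y : ℝ => v + (y / (1 + y)) • (v' - v)) ?_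
      (Metric.isOpen_ball.mem_nhds (by simpa using hv))
    have : ContinuousAt (fun y : ℝ => y / (1 + y)) 0 :=
      ContinuousAt.div (by fun_prop) (by fun_prop) (by norm_num)
    fun_prop
  have ev3 : ∀ᶠ y : ℝ in nhds 0, (1 + y) ≠ 0 :=
    ContinuousAt.eventually_ne (by fun_prop) (by norm_num)
  obtain ⟨δ, hδ, hall⟩ := Metric.eventually_nhds_iff.1 (ev1.and (ev2.and ev3))
  -- By homogeneity a quadratic in `y` equals a quadratic in `y / (1 + y)`. Clearing `(1 + y)²`
  -- leaves a quartic identity that kills every nonconstant coefficient.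
  have key := quartic_coeffs_eq_zero (p₀ := a - a') (p₁ := 2 * a + b - (b' + 2 * a'))
    (p₂ := a + b + c - (c' + 2 * b' + a')) (p₃ := -(2 * c' + b')) (p₄ := -c') hδ (by
      intro y hy
      obtain ⟨m1, m2, m3⟩ := hall (y := y) (by simpa using hy)
      have e : v + y • v' = (1 + y) • (v + (y / (1 + y)) • (v' - v)) := by
        rw [smul_add, smul_smul, mul_div_cancel₀ _ m3]
        module
      have e2 := h2 y m1
      rw [e, hhom _ m2 _ m3 (e ▸ m1), h1 _ m2] at e2
      field_simp at e2
      linear_combination e2)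
  obtain ⟨k0, k1, k2, k3, k4⟩ := key
  have hb : b = 0 := by linarith
  have hc : c = 0 := by linarith
  have hone := h1 1 (by simpa using hv')
  have hzero := h1 0 (by simpa using hv)
  simp only [hb, hc, one_smul, zero_smul, add_zero, zero_mul] at hone hzero
  rw [hzero, ← hone]
  congr 1
  abel

/-- A homogeneous function of degree `2` which is quadratic on the line segments of a ball, and
whose second differences at the centre are given by itself, satisfies the parallelogram law and is
quadratic on all lines. -/
theorem parallelogram_of_quadratic_on_ball {V : Type*} [NormedAddCommGroup V]
    [NormedSpace ℝ V] {q : V → ℝ} {z₀ : V} {ρ : ℝ} (hρ : 0 < ρ)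
    (hhom : ∀ (t : ℝ) (h : V), q (t • h) = t ^ 2 * q h)
    (hquad : ∀ v ∈ Metric.ball z₀ ρ, ∀ w : V, ∃ a b c : ℝ, ∀ t : ℝ,
      v + t • w ∈ Metric.ball z₀ ρ → q (v + t • w) = a + b * t + c * t ^ 2)
    (hdiff : ∀ h : V, ‖h‖ < ρ → q (z₀ + h) + q (z₀ - h) = 2 * q z₀ + 2 * q h) :
    (∀ x y : V, q (x + y) + q (x - y) = 2 * q x + 2 * q y) ∧
    (∀ x y : V, ∃ a b c : ℝ, ∀ t : ℝ, |t| ≤ 1 → q (x + t • y) = a + b * t + c * t ^ 2) := by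
  have hmem : ∀ {v h : V}, v ∈ Metric.ball z₀ (ρ / 2) → ‖h‖ < ρ / 2 →
      v + h ∈ Metric.ball z₀ ρ := by
    intro v h hv hh
    rw [mem_ball_iff_norm] at hv ⊢
    calc ‖v + h - z₀‖ = ‖(v - z₀) + h‖ := by congr 1; abel
      _ ≤ ‖v - z₀‖ + ‖h‖ := norm_add_le _ _
      _ < ρ := by linarith
  have hD : ∀ h : V, ‖h‖ < ρ / 2 → ∀ v ∈ Metric.ball z₀ (ρ / 2),
      q (v + h) + q (v - h) = 2 * q v + 2 * q h := by
    intro h hh v hv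
    have hz : z₀ ∈ Metric.ball z₀ (ρ / 2) := Metric.mem_ball_self (by linarith)
    have hh' : ‖-h‖ < ρ / 2 := by rwa [norm_neg]
    have h0 : ‖(0 : V)‖ < ρ / 2 := by rw [norm_zero]; linarith
    have := eq_of_quadratic_on_lines_of_homogeneous
      (D := fun v => q (v + h) + q (v - h) - 2 * q v) (z₀ := z₀) (ρ := ρ / 2) ?_ ?_ hz hv
    · have := hdiff h (by linarith)
      linarith
    · intro v hv w
      obtain ⟨a₁, b₁, c₁, e₁⟩ := hquad (v + h) (hmem hv hh) w
      obtain ⟨a₂, b₂, c₂, e₂⟩ := hquad (v + -h) (hmem hv hh') w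
      obtain ⟨a₃, b₃, c₃, e₃⟩ := hquad (v + 0) (hmem hv h0) w
      refine ⟨a₁ + a₂ - 2 * a₃, b₁ + b₂ - 2 * b₃, c₁ + c₂ - 2 * c₃, fun t ht => ?_⟩
      have i₁ := e₁ t (by rw [add_right_comm]; exact hmem ht hh)
      have i₂ := e₂ t (by rw [add_right_comm]; exact hmem ht hh')
      have i₃ := e₃ t (by rw [add_right_comm]; exact hmem ht h0)
      rw [add_right_comm] at i₁ i₂ i₃
      rw [add_zero] at i₃
      rw [sub_eq_add_neg (v + t • w) h, i₁, i₂, i₃]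
      ring
    · intro v hv s hs hsv
      obtain ⟨a, b, c, e⟩ := hquad (s • v + 0) (hmem hsv h0) h
      obtain ⟨a', b', c', e'⟩ := hquad (v + 0) (hmem hv h0) h
      simp only [add_zero] at e e'
      have ev : ∀ᶠ t : ℝ in nhds 0, s • v + t • h ∈ Metric.ball z₀ ρ ∧
          v + (s⁻¹ * t) • h ∈ Metric.ball z₀ ρ := by
        refine Filter.Eventually.and ?_ ?_
        · exact ContinuousAt.eventually_mem (f := fun t : ℝ => s • v + t • h) (by fun_prop)
            (Metric.isOpen_ball.mem_nhds (by simpa using hmem hsv h0))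
        · exact ContinuousAt.eventually_mem (f := fun t : ℝ => v + (s⁻¹ * t) • h) (by fun_prop)
            (Metric.isOpen_ball.mem_nhds (by simpa using hmem hv h0))
      obtain ⟨δ, hδ, hall⟩ := Metric.eventually_nhds_iff.1 ev
      -- The second difference is twice the `t²` coefficient along `h`, and `q (s • v + t • h) = s²
      -- q (v + (t / s) • h)` leaves that coefficient unchanged.
      have key := quartic_coeffs_eq_zero (p₀ := a - s ^ 2 * a') (p₁ := b - s * b')
        (p₂ := c - c') (p₃ := 0) (p₄ := 0) hδ (by
          intro t ht
          obtain ⟨m1, m2⟩ := hall (y := t) (by simpa using ht)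
          have e1 := e t m1
          have e2 := e' _ m2
          have e3 : s • v + t • h = s • (v + (s⁻¹ * t) • h) := by
            rw [smul_add, smul_smul, mul_inv_cancel_left₀ hs]
          rw [e3, hhom, e2] at e1
          field_simp at e1
          linear_combination -e1)
      have f0 := e 0 (by simpa using hmem hsv h0)
      have f1 := e 1 (by simpa using hmem hsv hh)
      have f2 := e (-1) (by simpa using hmem hsv hh')
      have g0 := e' 0 (by simpa using hmem hv h0)
      have g1 := e' 1 (by simpa using hmem hv hh)
      have g2 := e' (-1) (by simpa using hmem hv hh')
      simp only [zero_smul, one_smul, neg_smul, add_zero, ← sub_eq_add_neg] at f0 f1 f2 g0 g1 g2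
      rw [f0, f1, f2, g0, g1, g2]
      linarith [key.2.2.1]
  have hz : z₀ ∈ Metric.ball z₀ (ρ / 2) := Metric.mem_ball_self (by linarith)
  have hscale : ∀ x y : V, ∃ ε : ℝ, 0 < ε ∧ ‖ε • x‖ < ρ / 8 ∧ ‖ε • y‖ < ρ / 8 := by
    intro x y
    have hx : ∀ᶠ ε : ℝ in nhds 0, ‖ε • x‖ < ρ / 8 :=
      ContinuousAt.eventually_lt (f := fun ε : ℝ => ‖ε • x‖) (by fun_prop) (by fun_prop)
        (by simpa using hρ)
    have hy : ∀ᶠ ε : ℝ in nhds 0, ‖ε • y‖ < ρ / 8 :=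
      ContinuousAt.eventually_lt (f := fun ε : ℝ => ‖ε • y‖) (by fun_prop) (by fun_prop)
        (by simpa using hρ)
    obtain ⟨δ, hδ, hall⟩ := Metric.eventually_nhds_iff.1 (hx.and hy)
    refine ⟨δ / 2, by linarith, hall ?_⟩
    rw [dist_zero_right, Real.norm_eq_abs, abs_of_pos (by linarith)]
    linarith
  constructor
  · intro x y
    obtain ⟨ε, hε, hx, hy⟩ := hscale x y
    have nx := norm_add_le (ε • x) (ε • y)
    have ny := norm_sub_le (ε • x) (ε • y)
    have mx : z₀ + ε • x ∈ Metric.ball z₀ (ρ / 2) := by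
      rw [mem_ball_iff_norm, add_sub_cancel_left]; linarith
    have mx' : z₀ - ε • x ∈ Metric.ball z₀ (ρ / 2) := by
      rw [mem_ball_iff_norm, sub_sub_cancel_left, norm_neg]; linarith
    have e1 := hD (ε • x + ε • y) (by linarith) z₀ hz
    have e2 := hD (ε • x - ε • y) (by linarith) z₀ hz
    have e3 := hD (ε • y) (by linarith) _ mx
    have e4 := hD (ε • y) (by linarith) _ mx'
    have e5 := hD (ε • x) (by linarith) z₀ hz
    have r1 : z₀ + ε • x + ε • y = z₀ + (ε • x + ε • y) := by abel
    have r2 : z₀ + ε • x - ε • y = z₀ + (ε • x - ε • y) := by abel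
    have r3 : z₀ - ε • x + ε • y = z₀ - (ε • x - ε • y) := by abel
    have r4 : z₀ - ε • x - ε • y = z₀ - (ε • x + ε • y) := by abel
    rw [r1, r2] at e3
    rw [r3, r4] at e4
    rw [← smul_add, hhom] at e1
    rw [← smul_sub, hhom] at e2
    rw [← smul_add, ← smul_sub, hhom] at e3 e4
    rw [hhom] at e5
    have : ε ^ 2 * (q (x + y) + q (x - y)) = ε ^ 2 * (2 * q x + 2 * q y) := by linarith
    exact mul_left_cancel₀ (by positivity) this
  · intro x y
    obtain ⟨ε, hε, hx, hy⟩ := hscale x y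
    have mx : z₀ + ε • x ∈ Metric.ball z₀ ρ := by
      rw [mem_ball_iff_norm, add_sub_cancel_left]; linarith
    have mx' : z₀ - ε • x ∈ Metric.ball z₀ ρ := by
      rw [mem_ball_iff_norm, sub_sub_cancel_left, norm_neg]; linarith
    obtain ⟨a, b, c, e⟩ := hquad _ mx (ε • y)
    obtain ⟨a', b', c', e'⟩ := hquad _ mx' (ε • y)
    -- Solve `hdiff` at `ε • (x + t • y)` for `q (x + t • y)`. The second quadratic is evaluated at
    -- `-t`, hence `b - b'`.
    refine ⟨(a + a' - 2 * q z₀) / (2 * ε ^ 2), (b - b') / (2 * ε ^ 2), (c + c') / (2 * ε ^ 2),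
      fun t ht => ?_⟩
    have ht' : ‖t • ε • y‖ < ρ / 8 := by
      rw [norm_smul, Real.norm_eq_abs]
      nlinarith [norm_nonneg (ε • y)]
    have n1 := norm_add_le (ε • x) (t • ε • y)
    have r1 : z₀ + ε • x + t • ε • y = z₀ + (ε • x + t • ε • y) := by abel
    have r2 : z₀ - ε • x + (-t) • ε • y = z₀ - (ε • x + t • ε • y) := by
      rw [neg_smul]; abel
    have i := e t (by rw [r1, mem_ball_iff_norm, add_sub_cancel_left]; linarith)
    have i' := e' (-t) (by rw [r2, mem_ball_iff_norm, sub_sub_cancel_left, norm_neg]; linarith)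
    have j := hdiff (ε • x + t • ε • y) (by linarith)
    rw [← r1, ← r2, i, i', smul_comm t ε y, ← smul_add, hhom] at j
    field_simp
    linarith

/-! ### From the parallelogram law to a Hermitian norm -/

section InnerProduct

variable {V : Type*} [AddCommGroup V] [Module ℂ V] {q : V → ℝ}

theorem polar_add_of_parallelogram (hhom : ∀ (ζ : ℂ) (x : V), q (ζ • x) = ‖ζ‖ ^ 2 * q x)
    (hpar : ∀ x y : V, q (x + y) + q (x - y) = 2 * q x + 2 * q y) (x x' y : V) :
    q (x + x' + y) - q (x + x' - y) = (q (x + y) - q (x - y)) + (q (x' + y) - q (x' - y)) := by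
  have hneg : ∀ x, q (-x) = q x := fun x => by simpa using hhom (-1) x
  have key : ∀ u u' : V, q (u + u' + (2 : ℂ) • y) - q (u + u' - (2 : ℂ) • y) =
      2 * ((q (u + y) - q (u - y)) + (q (u' + y) - q (u' - y))) := by
    intro u u'
    have e1 := hpar (u + y) (u' + y)
    have e2 := hpar (u - y) (u' - y)
    rw [show u + y + (u' + y) = u + u' + (2 : ℂ) • y by module,
      show u + y - (u' + y) = u - u' by abel] at e1
    rw [show u - y + (u' - y) = u + u' - (2 : ℂ) • y by module,
      show u - y - (u' - y) = u - u' by abel] at e2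
    linarith
  have k1 := key x x'
  have k2 := key (x + x') 0
  rw [add_zero, zero_add, zero_sub, hneg] at k2
  linarith

/-- Jordan–von Neumann: a positive function that is homogeneous of degree `2`, satisfies the
parallelogram law and is quadratic on line segments is the square of a Hermitian norm. -/
theorem exists_linearEquiv_norm_sq [FiniteDimensional ℂ V]
    (hhom : ∀ (ζ : ℂ) (x : V), q (ζ • x) = ‖ζ‖ ^ 2 * q x)
    (hpos : ∀ x : V, x ≠ 0 → 0 < q x)
    (hpar : ∀ x y : V, q (x + y) + q (x - y) = 2 * q x + 2 * q y)
    (hquad : ∀ x y : V, ∃ a b c : ℝ, ∀ t : ℝ, |t| ≤ 1 →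
      q (x + (t : ℂ) • y) = a + b * t + c * t ^ 2) :
    ∃ e : EuclideanSpace ℂ (Fin (Module.finrank ℂ V)) ≃ₗ[ℂ] V, ∀ y, q (e y) = ‖y‖ ^ 2 := by
  have hzero : q 0 = 0 := by simpa using hhom 0 0
  have hneg : ∀ x, q (-x) = q x := fun x => by simpa using hhom (-1) x
  obtain ⟨B, hB⟩ : ∃ B : V → V → ℝ, ∀ x y, B x y = (q (x + y) - q (x - y)) / 4 := ⟨_, fun _ _ => rfl⟩
  have hadd : ∀ x x' y, B (x + x') y = B x y + B x' y := fun x x' y => by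
    rw [hB, hB, hB, polar_add_of_parallelogram hhom hpar]; ring
  have hsymm : ∀ x y, B x y = B y x := fun x y => by
    rw [hB, hB, add_comm, ← hneg (x - y), neg_sub]
  have hline : ∀ (t : ℝ) x y, |t| ≤ 1 → B ((t : ℂ) • x) y = t * B x y := by
    intro t x y ht
    obtain ⟨a, b, c, h⟩ := hquad y x
    have e1 := h t ht
    have e2 := h (-t) (by rwa [abs_neg])
    have e3 := h 1 (by simp)
    have e4 := h (-1) (by simp)
    simp only [Complex.ofReal_neg, neg_smul, ← sub_eq_add_neg, Complex.ofReal_one, one_smul]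
      at e2 e3 e4
    rw [hsymm, hsymm x, hB, hB, e1, e2, e3, e4]
    ring
  have hreal : ∀ (t : ℝ) x y, B ((t : ℂ) • x) y = t * B x y := by
    intro t x y
    by_cases ht : |t| ≤ 1
    · exact hline t x y ht
    · have h0 : t ≠ 0 := by rintro rfl; simp at ht
      -- For `|t| > 1`, apply the bounded case to `t⁻¹` and the vector `t • x`.
      have := hline t⁻¹ ((t : ℂ) • x) y (by rw [abs_inv]; exact inv_le_one_of_one_le₀ (by linarith))
      rw [smul_smul, ← Complex.ofReal_mul, inv_mul_cancel₀ h0, Complex.ofReal_one, one_smul] at this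
      rw [this, mul_inv_cancel_left₀ h0]
  have hneg' : ∀ x y, B (-x) y = - B x y := fun x y => by simpa using hreal (-1) x y
  have hI : ∀ x y, B (Complex.I • x) (Complex.I • y) = B x y := fun x y => by
    rw [hB, hB, ← smul_add, ← smul_sub, hhom, hhom]; simp
  have hII : ∀ x : V, Complex.I • Complex.I • x = -x := fun x => by simp [smul_smul]
  have hIswap : ∀ x y, B (Complex.I • x) y = - B (Complex.I • y) x := fun x y => by
    rw [← hI, hII, hneg', hsymm]
  have hself : ∀ x, B x x = q x := fun x => by
    have := hhom 2 x
    rw [hB, sub_self, hzero, ← two_smul ℂ x, this]; norm_num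
  -- The imaginary part `B (I • x) y` is forced by conjugate linearity in the first variable.
  let core : InnerProductSpace.Core ℂ V :=
    { inner := fun x y => ⟨B x y, B (Complex.I • x) y⟩
      conj_inner_symm := fun x y => by
        apply Complex.ext
        · simp [hsymm x y]
        · simp [hIswap x y]
      re_inner_nonneg := fun x => by
        by_cases hx : x = 0
        · simp [hself, hx, hzero]
        · simpa [hself] using (hpos x hx).le
      add_left := fun x y z => by
        apply Complex.ext <;> simp [hadd]
      smul_left := fun x y r => by
        have hr : r • x = (r.re : ℂ) • x + (r.im : ℂ) • Complex.I • x := by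
          rw [smul_smul, ← add_smul, Complex.re_add_im]
        have hr' : Complex.I • r • x = (r.re : ℂ) • Complex.I • x + (r.im : ℂ) • -x := by
          rw [← hII x, hr, smul_add, smul_comm, smul_comm Complex.I (r.im : ℂ)]
        apply Complex.ext
        · simp only [hr, hadd, hreal, Complex.mul_re, Complex.conj_re, Complex.conj_im]
          ring
        · simp only [hr', hadd, hreal, hneg', Complex.mul_im, Complex.conj_re, Complex.conj_im]
          ring
      definite := fun x hx => by
        by_contra hne
        have := congrArg Complex.re hx
        simp only [hself, Complex.zero_re] at this
        exact (hpos x hne).ne' this }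
  let _ : NormedAddCommGroup V := core.toNormedAddCommGroup
  let _ : InnerProductSpace ℂ V := InnerProductSpace.ofCore core.toCore
  refine ⟨(stdOrthonormalBasis ℂ V).repr.symm.toLinearEquiv, fun y => ?_⟩
  have h1 : ‖(stdOrthonormalBasis ℂ V).repr.symm y‖ = ‖y‖ := LinearIsometryEquiv.norm_map _ _
  rw [← h1, norm_sq_eq_re_inner (𝕜 := ℂ)]
  exact (hself _).symm

end InnerProduct

/-- A set with at least two points cut out by a positive definite Hermitian quadratic inequality is
a complex ellipsoid. -/
theorem isComplexEllipsoid_of_forall_mem_iff {n : ℕ} {K : Set (EuclideanSpace ℂ (Fin n))}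
    {q : EuclideanSpace ℂ (Fin n) → ℝ} {l : EuclideanSpace ℂ (Fin n) →ₗ[ℂ] ℂ} {c : ℝ}
    (e : EuclideanSpace ℂ (Fin n) ≃ₗ[ℂ] EuclideanSpace ℂ (Fin n))
    (he : ∀ y, q (e y) = ‖y‖ ^ 2) (hK : K.Nontrivial)
    (hmem : ∀ z, z ∈ K ↔ q z - 2 * (l z).re + c ≤ 0) : IsComplexEllipsoid n K := by
  set m : EuclideanSpace ℂ (Fin n) →ₗ[ℂ] ℂ := l ∘ₗ e.toLinearMap with hm
  set b := (InnerProductSpace.toDual ℂ (EuclideanSpace ℂ (Fin n))).symm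
    (LinearMap.toContinuousLinearMap m) with hb
  have hbm : ∀ y, inner ℂ b y = l (e y) := fun y => by
    rw [hb, InnerProductSpace.toDual_symm_apply]; rfl
  have hmem' : ∀ y, e y ∈ K ↔ ‖y - b‖ ^ 2 ≤ ‖b‖ ^ 2 - c := by
    intro y
    rw [hmem, he, ← hbm, @norm_sub_sq ℂ, ← inner_conj_symm y b]
    simp only [RCLike.re_to_complex, Complex.conj_re]
    constructor <;> intro h <;> linarith
  have hR : 0 < ‖b‖ ^ 2 - c := by
    by_contra hR
    have huniq : ∀ z ∈ K, e.symm z = b := fun z hz => by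
      have := (hmem' (e.symm z)).1 (by simpa using hz)
      have h0 : ‖e.symm z - b‖ ^ 2 ≤ 0 := by linarith
      have : ‖e.symm z - b‖ = 0 := by nlinarith [norm_nonneg (e.symm z - b)]
      rwa [norm_eq_zero, sub_eq_zero] at this
    obtain ⟨x, hx, y, hy, hne⟩ := hK
    exact hne (e.symm.injective ((huniq x hx).trans (huniq y hy).symm))
  set R := Real.sqrt (‖b‖ ^ 2 - c) with hRdef
  have hR0 : 0 < R := Real.sqrt_pos.2 hR
  have hRC : (R : ℂ) ≠ 0 := by exact_mod_cast hR0.ne'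
  have hRsq : R ^ 2 = ‖b‖ ^ 2 - c := Real.sq_sqrt hR.le
  obtain ⟨f, hf⟩ : ∃ f : EuclideanSpace ℂ (Fin n) →ᵃ[ℂ] EuclideanSpace ℂ (Fin n),
      ∀ y, f y = e ((R : ℂ) • y + b) :=
    ⟨((R : ℂ) • e.toLinearMap).toAffineMap + AffineMap.const ℂ _ (e b), fun y => by
      rw [map_add, map_smul]; rfl⟩
  refine ⟨f, ?_, ?_⟩
  · intro x y hxy
    rw [hf, hf, e.injective.eq_iff, add_left_inj] at hxy
    exact smul_right_injective _ hRC hxy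
  · ext z
    constructor
    · intro hz
      refine ⟨(R : ℂ)⁻¹ • (e.symm z - b), ?_, ?_⟩
      · have := (hmem' (e.symm z)).1 (by simpa using hz)
        rw [← hRsq, sq_le_sq₀ (norm_nonneg _) hR0.le] at this
        rw [mem_closedBall_zero_iff, norm_smul, norm_inv, Complex.norm_real, Real.norm_eq_abs,
          abs_of_pos hR0, inv_mul_le_iff₀ hR0, mul_one]
        exact this
      · rw [hf, smul_inv_smul₀ hRC, sub_add_cancel, LinearEquiv.apply_symm_apply]
    · rintro ⟨y, hy, rfl⟩
      rw [mem_closedBall_zero_iff] at hy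
      rw [hf]
      refine (hmem' _).2 ?_
      rw [add_sub_cancel_right, norm_smul, Complex.norm_real, Real.norm_eq_abs, abs_of_pos hR0,
        ← hRsq, mul_pow]
      have : ‖y‖ ^ 2 ≤ 1 := pow_le_one₀ (norm_nonneg _) hy
      nlinarith [sq_nonneg R]

/-! ### Complex subspaces and the equations of their sections -/

theorem exists_submodule_finrank_eq {V : Type*} [AddCommGroup V] [Module ℂ V]
    [FiniteDimensional ℂ V] (S : Submodule ℂ V) {d : ℕ} (hd : Module.finrank ℂ S ≤ d)
    (hdn : d ≤ Module.finrank ℂ V) : ∃ H : Submodule ℂ V, S ≤ H ∧ Module.finrank ℂ H = d := by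
  induction d, hd using Nat.le_induction with
  | base => exact ⟨S, le_rfl, rfl⟩
  | succ d hd ih =>
    obtain ⟨H, hSH, hH⟩ := ih (by omega)
    obtain ⟨v, hv⟩ : ∃ v, v ∉ H := by
      by_contra! h
      have : H = ⊤ := by ext; simp [h]
      rw [this, finrank_top] at hH
      omega
    exact ⟨H ⊔ Submodule.span ℂ {v}, hSH.trans le_sup_left, by
      rw [Submodule.finrank_sup_span_singleton hv, hH]⟩

theorem exists_submodule_finrank_eq_mem {V : Type*} [AddCommGroup V] [Module ℂ V]
    [FiniteDimensional ℂ V] {k : ℕ} (hk : 2 ≤ k) (hkn : k ≤ Module.finrank ℂ V) (u v : V) :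
    ∃ H : Submodule ℂ V, Module.finrank ℂ H = k ∧ u ∈ H ∧ v ∈ H := by
  classical
  obtain ⟨H, hle, hH⟩ := exists_submodule_finrank_eq (Submodule.span ℂ ({u, v} : Set V)) (d := k)
    (by
      have h := finrank_span_finset_le_card (R := ℂ) ({u, v} : Finset V)
      rw [Finset.coe_insert, Finset.coe_singleton] at h
      exact (h.trans Finset.card_le_two).trans hk) hkn
  exact ⟨H, hH, hle (Submodule.subset_span (by simp)), hle (Submodule.subset_span (by simp))⟩

/-- The linear part of the parametrization has range `H`; a left inverse of it, defined on the whole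
space, carries the section back to the unit ball. -/
theorem exists_linearMap_norm_le_one_iff {n k : ℕ} {K : Set (EuclideanSpace ℂ (Fin n))}
    {H : Submodule ℂ (EuclideanSpace ℂ (Fin n))} (hH : Module.finrank ℂ H = k)
    (hE : IsComplexEllipsoid k ((H : Set (EuclideanSpace ℂ (Fin n))) ∩ K)) :
    ∃ (A : EuclideanSpace ℂ (Fin n) →ₗ[ℂ] EuclideanSpace ℂ (Fin k)) (b : EuclideanSpace ℂ (Fin k)),
      (∀ z ∈ H, A z = 0 → z = 0) ∧ ∀ z ∈ H, z ∈ K ↔ ‖A z + b‖ ≤ 1 := by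
  obtain ⟨f, hf, hS⟩ := hE
  have hfx : ∀ x, f x = f.linear x + f 0 := fun x => by
    simpa using f.map_vadd 0 x
  have hmemH : ∀ x, ‖x‖ ≤ 1 → f x ∈ H := fun x hx =>
    (hS.symm.subset ⟨x, mem_closedBall_zero_iff.2 hx, rfl⟩).1
  have h0 : f 0 ∈ H := hmemH 0 (by simp)
  have hlin : ∀ x, f.linear x ∈ H := by
    intro x
    by_cases hx : x = 0
    · simp [hx]
    have hnx : (‖x‖ : ℂ) ≠ 0 := by simpa using hx
    have h1 := hmemH ((‖x‖ : ℂ)⁻¹ • x) (by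
      rw [norm_smul, norm_inv, Complex.norm_real, norm_norm, inv_mul_cancel₀ (by simpa using hx)])
    rw [hfx] at h1
    have h2 := (Submodule.add_mem_iff_left _ h0).1 h1
    rw [map_smul] at h2
    exact (Submodule.smul_mem_iff _ (inv_ne_zero hnx)).1 h2
  have hinj : Function.Injective f.linear := f.linear_injective_iff.2 hf
  have hrange : LinearMap.range f.linear = H := by
    apply Submodule.eq_of_le_of_finrank_eq
    · rintro _ ⟨x, rfl⟩
      exact hlin x
    · rw [LinearMap.finrank_range_of_inj hinj, hH, finrank_euclideanSpace_fin]
  obtain ⟨g, hg⟩ := f.linear.exists_leftInverse_of_injective (LinearMap.ker_eq_bot.2 hinj)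
  have hg' : ∀ x, g (f.linear x) = x := fun x => LinearMap.congr_fun hg x
  refine ⟨g, -g (f 0), ?_, ?_⟩
  · intro z hz hgz
    rw [← hrange] at hz
    obtain ⟨x, rfl⟩ := hz
    rw [hg'] at hgz
    simp [hgz]
  · intro z hz
    rw [← sub_eq_add_neg, ← map_sub]
    have hz' : z - f 0 ∈ LinearMap.range f.linear := hrange ▸ H.sub_mem hz h0
    obtain ⟨x, hx⟩ := hz'
    have hzx : z = f x := by rw [hfx, hx, sub_add_cancel]
    have hiff : z ∈ K ↔ z ∈ f '' Metric.closedBall 0 1 := by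
      rw [← hS]; exact ⟨fun h => ⟨hz, h⟩, fun h => h.2⟩
    rw [hiff, ← hx, hg', hzx, hf.mem_set_image, mem_closedBall_zero_iff]

/-- The half-space condition forces `ker g ≤ ker f`, so `f = κ g`; multiplication by `κ` keeps the
left half-plane in its closure, so `κ` is real and positive. This compares the tangent functional of
a section with a supporting functional of `K`. -/
theorem exists_pos_smul_eq_of_re_neg_imp {V : Type*} [AddCommGroup V] [Module ℂ V]
    {f g : V →ₗ[ℂ] ℂ} {z₁ : V} (hf : f z₁ ≠ 0) (hg : (g z₁).re < 0)
    (h : ∀ z, (g z).re < 0 → (f z).re ≤ 0) : ∃ s : ℝ, 0 < s ∧ ∀ z, f z = s * g z := by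
  have hg0 : g z₁ ≠ 0 := fun h0 => by simp [h0] at hg
  have hker : ∀ z, g z = 0 → (f z).re = 0 := by
    intro z hz
    by_contra hne
    have := h (z₁ + (((1 - (f z₁).re) / (f z).re : ℝ) : ℂ) • z) (by simpa [hz] using hg)
    rw [map_add, map_smul, smul_eq_mul, Complex.add_re, Complex.re_ofReal_mul,
      div_mul_cancel₀ _ hne] at this
    linarith
  have hker' : ∀ z, g z = 0 → f z = 0 := by
    intro z hz
    apply Complex.ext
    · exact hker z hz
    · have := hker (Complex.I • z) (by simp [hz])
      simpa using this
  set κ := f z₁ / g z₁ with hκ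
  have hfg : ∀ z, f z = κ * g z := by
    intro z
    have := hker' (z - (g z / g z₁) • z₁) (by simp [hg0])
    rw [map_sub, map_smul, smul_eq_mul, sub_eq_zero] at this
    rw [this, hκ]
    field_simp
  have hκ0 : κ ≠ 0 := div_ne_zero hf hg0
  have hhalf : ∀ w : ℂ, w.re < 0 → (κ * w).re ≤ 0 := by
    intro w hw
    have := h ((w / g z₁) • z₁) (by simpa [hg0] using hw)
    rwa [hfg, map_smul, smul_eq_mul, div_mul_cancel₀ _ hg0] at this
  have hre : 0 ≤ κ.re := by simpa using hhalf (-1) (by simp)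
  have him : κ.im = 0 := by
    by_contra hne
    -- This `w` is chosen to give `Re (κ w) = 1`.
    have := hhalf ⟨-1, -(κ.re + 1) / κ.im⟩ (by simp)
    rw [Complex.mul_re] at this
    simp only at this
    rw [mul_div_cancel₀ _ hne] at this
    linarith
  have hκr : κ = (κ.re : ℂ) := Complex.ext (by simp) (by simp [him])
  refine ⟨κ.re, lt_of_le_of_ne hre fun h0 => hκ0 ?_, fun z => by rw [← hκr]; exact hfg z⟩
  rw [hκr, ← h0, Complex.ofReal_zero]

/-- The section of `K` by the subspace `H` is given by the positive definite Hermitian inequality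
`‖A z‖² - 2 Re l z + c ≤ 0`. -/
def IsHermitianSection {n k : ℕ} (K : Set (EuclideanSpace ℂ (Fin n))) (c : ℝ)
    (lam : EuclideanSpace ℂ (Fin n) →ₗ[ℂ] ℂ) (H : Submodule ℂ (EuclideanSpace ℂ (Fin n)))
    (A : EuclideanSpace ℂ (Fin n) →ₗ[ℂ] EuclideanSpace ℂ (Fin k))
    (l : EuclideanSpace ℂ (Fin n) →ₗ[ℂ] ℂ) : Prop :=
  (∀ z ∈ H, A z = 0 → z = 0) ∧ (∀ z ∈ H, z ∈ K ↔ ‖A z‖ ^ 2 - 2 * (l z).re + c ≤ 0) ∧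
    (c = 0 → ∀ z ∈ H, l z = lam z)

/-- Expand `‖A z + b‖² ≤ 1` and multiply by `s`: the new data are `√s A` and `l = -s ⟨b, A ·⟩`. -/
theorem isHermitianSection_smul {n k : ℕ} {K : Set (EuclideanSpace ℂ (Fin n))}
    {lam : EuclideanSpace ℂ (Fin n) →ₗ[ℂ] ℂ} {H : Submodule ℂ (EuclideanSpace ℂ (Fin n))}
    {A : EuclideanSpace ℂ (Fin n) →ₗ[ℂ] EuclideanSpace ℂ (Fin k)} {b : EuclideanSpace ℂ (Fin k)}
    (hA : ∀ z ∈ H, A z = 0 → z = 0) (hAb : ∀ z ∈ H, z ∈ K ↔ ‖A z + b‖ ≤ 1) {s c : ℝ} (hs : 0 < s)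
    (hc : s * (‖b‖ ^ 2 - 1) = c)
    (hlam : c = 0 → ∀ z ∈ H, lam z = -s * inner ℂ b (A z)) :
    ∃ (A' : EuclideanSpace ℂ (Fin n) →ₗ[ℂ] EuclideanSpace ℂ (Fin k))
      (l : EuclideanSpace ℂ (Fin n) →ₗ[ℂ] ℂ), IsHermitianSection K c lam H A' l := by
  have hsq : (Real.sqrt s : ℂ) ≠ 0 := by exact_mod_cast (Real.sqrt_pos.2 hs).ne'
  refine ⟨(Real.sqrt s : ℂ) • A, (-s : ℂ) • ((innerSL ℂ b).toLinearMap ∘ₗ A), ?_, ?_, ?_⟩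
  · intro z hz h
    refine hA z hz ?_
    rw [LinearMap.smul_apply] at h
    exact (smul_eq_zero.1 h).resolve_left hsq
  · intro z hz
    have e1 : ‖((Real.sqrt s : ℂ) • A) z‖ ^ 2 = s * ‖A z‖ ^ 2 := by
      rw [LinearMap.smul_apply, norm_smul, Complex.norm_real, Real.norm_eq_abs,
        abs_of_nonneg (Real.sqrt_nonneg s), mul_pow, Real.sq_sqrt hs.le]
    have e2 : (((-s : ℂ) • ((innerSL ℂ b).toLinearMap ∘ₗ A)) z).re = -s * (inner ℂ b (A z)).re := by
      have : ((-s : ℂ) • ((innerSL ℂ b).toLinearMap ∘ₗ A)) z = ((-s : ℝ) : ℂ) * inner ℂ b (A z) := by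
        push_cast; rfl
      rw [this, Complex.re_ofReal_mul]
    have e3 : ‖A z + b‖ ^ 2 = ‖A z‖ ^ 2 + 2 * (inner ℂ b (A z)).re + ‖b‖ ^ 2 := by
      rw [@norm_add_sq ℂ, inner_re_symm, RCLike.re_to_complex]
    rw [hAb z hz, ← sq_le_one_iff₀ (norm_nonneg _), e1, e2, e3, ← hc]
    constructor
    · intro h
      nlinarith
    · intro h
      by_contra! h'
      nlinarith
  · intro h0 z hz
    rw [hlam h0 z hz]
    rfl

theorem closedBall_injective_of_nonneg {a b : ℂ} {r s : ℝ} (hr : 0 ≤ r) (hs : 0 ≤ s)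
    (h : Metric.closedBall a r = Metric.closedBall b s) : a = b ∧ r = s := by
  have hrs : r = s := by
    have := congrArg Metric.diam h
    rw [Metric.diam_closedBall_eq _ hr, Metric.diam_closedBall_eq _ hs] at this
    linarith
  refine ⟨?_, hrs⟩
  subst hrs
  by_contra hab
  have hd : 0 < ‖a - b‖ := norm_pos_iff.2 (sub_ne_zero.2 hab)
  have hd' : (‖a - b‖ : ℂ) ≠ 0 := by exact_mod_cast hd.ne'
  -- The point of the first disc farthest from `b`, at distance `r + ‖a - b‖`.
  have hmem : a + ((r / ‖a - b‖ : ℝ) : ℂ) * (a - b) ∈ Metric.closedBall a r := by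
    rw [mem_closedBall_iff_norm, add_sub_cancel_left, norm_mul, Complex.norm_real,
      Real.norm_eq_abs, abs_of_nonneg (by positivity), div_mul_cancel₀ _ hd.ne']
  rw [h, mem_closedBall_iff_norm] at hmem
  have e : a + ((r / ‖a - b‖ : ℝ) : ℂ) * (a - b) - b =
      ((1 + r / ‖a - b‖ : ℝ) : ℂ) * (a - b) := by push_cast; ring
  rw [e, norm_mul, Complex.norm_real, Real.norm_eq_abs, abs_of_nonneg (by positivity), add_mul,
    div_mul_cancel₀ _ hd.ne'] at hmem
  linarith

/-- The coefficients of a disc, normalized by the constant term, or by the linear term when the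
constant term vanishes, are determined by the disc. -/
theorem disc_coeffs_unique {a a' c : ℝ} {m m' ζ₀ : ℂ} (ha : 0 < a) (ha' : 0 < a')
    (h₀ : ‖ζ₀‖ ^ 2 * a - 2 * (ζ₀ * m).re + c ≤ 0) (hc : c = 0 → m = m' ∧ m ≠ 0)
    (h : ∀ ζ : ℂ, ‖ζ‖ ^ 2 * a - 2 * (ζ * m).re + c ≤ 0 ↔
      ‖ζ‖ ^ 2 * a' - 2 * (ζ * m').re + c ≤ 0) : a = a' ∧ m = m' := by
  have hball : ∀ {a : ℝ} {m : ℂ}, 0 < a → ∀ ζ : ℂ, ‖ζ‖ ^ 2 * a - 2 * (ζ * m).re + c =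
      a * (‖ζ - (starRingEnd ℂ m) / a‖ ^ 2 - (‖m‖ ^ 2 / a ^ 2 - c / a)) := by
    intro a m ha ζ
    have hac : (a : ℂ) ≠ 0 := by exact_mod_cast ha.ne'
    have e : ζ - (starRingEnd ℂ m) / a = ((a⁻¹ : ℝ) : ℂ) * (a * ζ - starRingEnd ℂ m) := by
      push_cast; field_simp
    rw [e, norm_mul, mul_pow, Complex.norm_real, Real.norm_eq_abs, sq_abs, Complex.sq_norm,
      Complex.sq_norm, Complex.sq_norm, Complex.normSq_apply, Complex.normSq_apply,
      Complex.normSq_apply]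
    simp only [Complex.sub_re, Complex.sub_im, Complex.im_ofReal_mul,
      Complex.conj_re, Complex.conj_im, Complex.mul_re, Complex.ofReal_re, Complex.ofReal_im]
    field_simp
    ring
  have hiff : ∀ {a : ℝ} {m : ℂ}, 0 < a → 0 ≤ ‖m‖ ^ 2 / a ^ 2 - c / a → ∀ ζ : ℂ,
      ‖ζ‖ ^ 2 * a - 2 * (ζ * m).re + c ≤ 0 ↔
        ζ ∈ Metric.closedBall ((starRingEnd ℂ m) / a) (Real.sqrt (‖m‖ ^ 2 / a ^ 2 - c / a)) := by
    intro a m ha hR ζ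
    rw [hball ha, mem_closedBall_iff_norm, Real.le_sqrt (norm_nonneg _) hR]
    constructor
    · intro h
      by_contra! h'
      have := mul_pos ha (sub_pos.2 h')
      linarith
    · intro h
      exact mul_nonpos_of_nonneg_of_nonpos ha.le (by linarith)
  have hRnn : ∀ {a : ℝ} {m : ℂ}, 0 < a → ‖ζ₀‖ ^ 2 * a - 2 * (ζ₀ * m).re + c ≤ 0 →
      0 ≤ ‖m‖ ^ 2 / a ^ 2 - c / a := by
    intro a m ha h
    rw [hball ha] at h
    by_contra! h'
    have := mul_pos ha (sub_pos.2 (h'.trans_le (sq_nonneg ‖ζ₀ - (starRingEnd ℂ m) / a‖)))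
    linarith
  have hR := hRnn ha h₀
  have hR' := hRnn ha' ((h ζ₀).1 h₀)
  obtain ⟨hcen, hrad⟩ := closedBall_injective_of_nonneg (Real.sqrt_nonneg _) (Real.sqrt_nonneg _)
    (Set.ext fun ζ => (hiff ha hR ζ).symm.trans ((h ζ).trans (hiff ha' hR' ζ)))
  rw [Real.sqrt_inj hR hR'] at hrad
  have hac : (a : ℂ) ≠ 0 := by exact_mod_cast ha.ne'
  have hac' : (a' : ℂ) ≠ 0 := by exact_mod_cast ha'.ne'
  have hmm : a' * m = a * m' := by
    have := congrArg (starRingEnd ℂ) hcen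
    simp only [map_div₀, Complex.conj_conj, Complex.conj_ofReal] at this
    field_simp at this
    linear_combination this
  -- Equal centres leave a common scaling of `a` and `m`. It is fixed by `m = m' ≠ 0` if `c = 0`,
  -- and by the equal radii otherwise.
  by_cases hc0 : c = 0
  · obtain ⟨rfl, hm⟩ := hc hc0
    exact ⟨by exact_mod_cast (mul_right_cancel₀ hm hmm).symm, rfl⟩
  · have hnorm : ‖m‖ ^ 2 / a ^ 2 = ‖m'‖ ^ 2 / a' ^ 2 := by
      have := congrArg (fun z : ℂ => ‖z‖) hmm
      simp only [norm_mul, Complex.norm_real, Real.norm_eq_abs, abs_of_pos ha,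
        abs_of_pos ha'] at this
      rw [div_eq_div_iff (by positivity) (by positivity), ← mul_pow, ← mul_pow,
        mul_comm ‖m‖, mul_comm ‖m'‖, this]
    have hca : c / a = c / a' := by linarith
    have haa : a = a' := by
      field_simp at hca
      exact hca.symm
    subst haa
    exact ⟨rfl, mul_left_cancel₀ hac hmm⟩

/-- Both equations, restricted to the line `ℂ v`, describe the same disc `{ζ | ζ • v ∈ K}`, nonempty
because it contains `ζ = 1`. -/
theorem IsHermitianSection.unique {n k : ℕ} {K : Set (EuclideanSpace ℂ (Fin n))} {c : ℝ}
    {lam : EuclideanSpace ℂ (Fin n) →ₗ[ℂ] ℂ} {H H' : Submodule ℂ (EuclideanSpace ℂ (Fin n))}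
    {A A' : EuclideanSpace ℂ (Fin n) →ₗ[ℂ] EuclideanSpace ℂ (Fin k)}
    {l l' : EuclideanSpace ℂ (Fin n) →ₗ[ℂ] ℂ} (hS : IsHermitianSection K c lam H A l)
    (hS' : IsHermitianSection K c lam H' A' l') {v : EuclideanSpace ℂ (Fin n)} (hv : v ∈ H)
    (hv' : v ∈ H') (hvK : v ∈ K) (hv0 : v ≠ 0) (hlam : c = 0 → lam v ≠ 0) :
    ‖A v‖ ^ 2 = ‖A' v‖ ^ 2 ∧ l v = l' v := by
  obtain ⟨h1, h2, h3⟩ := hS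
  obtain ⟨h1', h2', h3'⟩ := hS'
  refine disc_coeffs_unique (c := c) (ζ₀ := 1) ?_ ?_ ?_ ?_ ?_
  · exact pow_pos (norm_pos_iff.2 fun h => hv0 (h1 v hv h)) 2
  · exact pow_pos (norm_pos_iff.2 fun h => hv0 (h1' v hv' h)) 2
  · simpa using (h2 v hv).1 hvK
  · intro hc
    rw [h3 hc v hv, h3' hc v hv']
    exact ⟨rfl, hlam hc⟩
  · intro ζ
    have e := h2 (ζ • v) (H.smul_mem _ hv)
    have e' := h2' (ζ • v) (H'.smul_mem _ hv')
    simp only [map_smul, norm_smul, mul_pow, smul_eq_mul] at e e'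
    exact e.symm.trans e'

/-- The sign of `‖b‖² - 1` records the position of the origin relative to `K`, so it is the same for
all sections and one `c` serves them all. On the boundary the scale is set by `lam`, minus a
supporting functional at the origin. -/
theorem exists_isHermitianSection {n k : ℕ} (hk : 2 ≤ k) {K : Set (EuclideanSpace ℂ (Fin n))}
    (hconv : Convex ℝ K) (hint : (interior K).Nonempty)
    (hsec : ∀ H : Submodule ℂ (EuclideanSpace ℂ (Fin n)), Module.finrank ℂ H = k →
      ((H : Set (EuclideanSpace ℂ (Fin n))) ∩ interior K).Nonempty →
      IsComplexEllipsoid k ((H : Set (EuclideanSpace ℂ (Fin n))) ∩ K)) :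
    ∃ (c : ℝ) (lam : EuclideanSpace ℂ (Fin n) →ₗ[ℂ] ℂ), (c = 0 → ∀ v ∈ interior K, lam v ≠ 0) ∧
      ∀ H : Submodule ℂ (EuclideanSpace ℂ (Fin n)), Module.finrank ℂ H = k →
        ((H : Set (EuclideanSpace ℂ (Fin n))) ∩ interior K).Nonempty →
        ∃ (A : EuclideanSpace ℂ (Fin n) →ₗ[ℂ] EuclideanSpace ℂ (Fin k))
          (l : EuclideanSpace ℂ (Fin n) →ₗ[ℂ] ℂ), IsHermitianSection K c lam H A l := by
  have hsmall : ∀ {s : Set (EuclideanSpace ℂ (Fin n))} (z : EuclideanSpace ℂ (Fin n)), IsOpen s →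
      0 ∈ s → ∃ ε : ℝ, 0 < ε ∧ (ε : ℂ) • z ∈ s ∧ (-ε : ℂ) • z ∈ s := by
    intro s z hs h0
    have ev : ∀ᶠ t : ℝ in nhds 0, (t : ℂ) • z ∈ s :=
      ContinuousAt.eventually_mem (f := fun t : ℝ => (t : ℂ) • z) (by fun_prop)
        (hs.mem_nhds (by simpa using h0))
    obtain ⟨δ, hδ, hall⟩ := Metric.eventually_nhds_iff.1 ev
    refine ⟨δ / 2, by linarith, hall ?_, ?_⟩
    · rw [dist_zero_right, Real.norm_eq_abs, abs_of_pos (by linarith)]; linarith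
    · have := hall (y := -(δ / 2)) (by
        rw [dist_zero_right, norm_neg, Real.norm_eq_abs, abs_of_pos (by linarith)]; linarith)
      simpa using this
  by_cases h0 : (0 : EuclideanSpace ℂ (Fin n)) ∈ interior K
  · refine ⟨-1, 0, fun h => by norm_num at h, fun H hH hHK => ?_⟩
    obtain ⟨A, b, hA, hAb⟩ := exists_linearMap_norm_le_one_iff hH (hsec H hH hHK)
    have hb : ‖b‖ ^ 2 < 1 := by
      obtain ⟨z, hz, hz0⟩ : ∃ z ∈ H, z ≠ 0 := by
        refine H.exists_mem_ne_zero_of_ne_bot ?_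
        rintro rfl
        rw [finrank_bot] at hH
        omega
      -- Both `ε • z` and `-ε • z` lie in `K`; the parallelogram law then gives `‖b‖² + ‖A (ε • z)‖²
      -- ≤ 1`.
      obtain ⟨ε, hε, h1, h2⟩ := hsmall z isOpen_interior h0
      have e1 := (hAb _ (H.smul_mem _ hz)).1 (interior_subset h1)
      have e2 := (hAb _ (H.smul_mem _ hz)).1 (interior_subset h2)
      rw [neg_smul, map_neg, neg_add_eq_sub] at e2
      rw [add_comm] at e1
      have hp := parallelogram_law_with_norm ℂ b (A ((ε : ℂ) • z))
      have hA0 : 0 < ‖A ((ε : ℂ) • z)‖ := by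
        refine norm_pos_iff.2 fun h => ?_
        have := hA _ (H.smul_mem _ hz) h
        rw [smul_eq_zero] at this
        exact this.elim (fun h => hε.ne' (by exact_mod_cast h)) hz0
      nlinarith [norm_nonneg (b + A ((ε : ℂ) • z)), norm_nonneg (b - A ((ε : ℂ) • z))]
    have hne : 1 - ‖b‖ ^ 2 ≠ 0 := by linarith
    refine isHermitianSection_smul hA hAb (s := (1 - ‖b‖ ^ 2)⁻¹) (inv_pos.2 (by linarith)) ?_
      fun h => by norm_num at h
    field_simp
    ring
  by_cases h0' : (0 : EuclideanSpace ℂ (Fin n)) ∈ K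
  · obtain ⟨f, hf⟩ := RCLike.geometric_hahn_banach_open_point (𝕜 := ℂ) hconv.interior
      isOpen_interior h0
    simp only [map_zero, RCLike.re_to_complex] at hf
    have hfK : ∀ z ∈ K, (f z).re ≤ 0 := by
      intro z hz
      have hz' : z ∈ closure (interior K) := by
        rw [hconv.closure_interior_eq_closure_of_nonempty_interior hint]
        exact subset_closure hz
      exact le_on_closure (f := fun z => (f z).re) (g := fun _ => 0) (fun x hx => (hf x hx).le)
        (by fun_prop) (by fun_prop) hz'
    refine ⟨0, -f.toLinearMap, fun _ v hv h => ?_, fun H hH hHK => ?_⟩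
    · have h1 : f v = 0 := by simpa using h
      have h2 := hf v hv
      rw [h1] at h2
      simp at h2
    · obtain ⟨A, b, hA, hAb⟩ := exists_linearMap_norm_le_one_iff hH (hsec H hH hHK)
      obtain ⟨z₁, hz₁, hz₁K⟩ := hHK
      have hz₁f := hf z₁ hz₁K
      have hb : ‖b‖ = 1 := by
        refine le_antisymm (by simpa using (hAb 0 H.zero_mem).1 h0') ?_
        by_contra! hlt
        -- If `‖b‖ < 1`, some `-ε • z₁` would lie in `K`, on the wrong side of the supporting
        -- hyperplane.
        obtain ⟨ε, hε, -, h2⟩ := hsmall z₁ (s := {z | ‖A z + b‖ < 1})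
          (isOpen_lt (by have := A.continuous_of_finiteDimensional; fun_prop) (by fun_prop))
          (by simpa using hlt)
        have h3 := hfK _ ((hAb _ (H.smul_mem _ hz₁)).2 (le_of_lt h2))
        rw [neg_smul, map_neg, map_smul, smul_eq_mul, Complex.neg_re, Complex.re_ofReal_mul] at h3
        nlinarith
      have hsq : ∀ z, ‖A z + b‖ ^ 2 = ‖A z‖ ^ 2 + 2 * (inner ℂ b (A z)).re + 1 := fun z => by
        rw [@norm_add_sq ℂ, inner_re_symm, hb, RCLike.re_to_complex]
        ring
      obtain ⟨s, hs, hfs⟩ := exists_pos_smul_eq_of_re_neg_imp (V := H)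
        (f := f.toLinearMap ∘ₗ H.subtype) (g := (innerSL ℂ b).toLinearMap ∘ₗ A ∘ₗ H.subtype)
        (z₁ := ⟨z₁, hz₁⟩)
        (fun h => by
          have h1 : f z₁ = 0 := h
          rw [h1] at hz₁f
          simp at hz₁f)
        (by
          have h1 := (hAb z₁ hz₁).1 (interior_subset hz₁K)
          have h2 := hsq z₁
          have h3 : 0 < ‖A z₁‖ := norm_pos_iff.2 fun h => by
            rw [hA z₁ hz₁ h] at hz₁f
            simp at hz₁f
          change (inner ℂ b (A z₁)).re < 0
          nlinarith [norm_nonneg (A z₁ + b)])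
        (by
          rintro ⟨z, hz⟩ hgz
          change (inner ℂ b (A z)).re < 0 at hgz
          change (f z).re ≤ 0
          set g := (inner ℂ b (A z)).re with hg
          -- Small enough that `t² ‖A z‖² + 2 t g = t (g - t) < 0`, which puts `t • z` in `K`.
          set t : ℝ := -g / (‖A z‖ ^ 2 + 1) with ht
          have ht0 : 0 < t := div_pos (by linarith) (by positivity)
          have htm : t * (‖A z‖ ^ 2 + 1) = -g := div_mul_cancel₀ _ (by positivity)
          have hmem : (t : ℂ) • z ∈ K := by
            rw [hAb _ (H.smul_mem _ hz), ← sq_le_one_iff₀ (norm_nonneg _), hsq, map_smul,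
              norm_smul, inner_smul_right, Complex.re_ofReal_mul, Complex.norm_real,
              Real.norm_eq_abs, abs_of_pos ht0, ← hg]
            nlinarith
          have := hfK _ hmem
          rw [map_smul, smul_eq_mul, Complex.re_ofReal_mul] at this
          exact nonpos_of_mul_nonpos_right this ht0)
      refine isHermitianSection_smul hA hAb hs (by rw [hb]; norm_num) fun _ z hz => ?_
      have h1 : f z = s * inner ℂ b (A z) := hfs ⟨z, hz⟩
      rw [LinearMap.neg_apply, neg_mul, ← h1]
      rfl
  · refine ⟨1, 0, fun h => by norm_num at h, fun H hH hHK => ?_⟩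
    obtain ⟨A, b, hA, hAb⟩ := exists_linearMap_norm_le_one_iff hH (hsec H hH hHK)
    have hb : 1 < ‖b‖ := by
      have := (hAb 0 H.zero_mem).not.1 h0'
      simpa using this
    have hb2 : 0 < ‖b‖ ^ 2 - 1 := by nlinarith
    exact isHermitianSection_smul hA hAb (s := (‖b‖ ^ 2 - 1)⁻¹) (inv_pos.2 hb2)
      (inv_mul_cancel₀ hb2.ne') fun h => by norm_num at h

/-! ### Gluing the sections into one Hermitian inequality -/

theorem isComplexEllipsoid_of_isHermitianSection {n k : ℕ} (hk : 2 ≤ k) (hkn : k < n)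
    {K : Set (EuclideanSpace ℂ (Fin n))} (hint : (interior K).Nonempty) {c : ℝ}
    {lam : EuclideanSpace ℂ (Fin n) →ₗ[ℂ] ℂ} (hlam : c = 0 → ∀ v ∈ interior K, lam v ≠ 0)
    (hsec : ∀ H : Submodule ℂ (EuclideanSpace ℂ (Fin n)), Module.finrank ℂ H = k →
      ((H : Set (EuclideanSpace ℂ (Fin n))) ∩ interior K).Nonempty →
      ∃ (A : EuclideanSpace ℂ (Fin n) →ₗ[ℂ] EuclideanSpace ℂ (Fin k))
        (l : EuclideanSpace ℂ (Fin n) →ₗ[ℂ] ℂ), IsHermitianSection K c lam H A l) :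
    IsComplexEllipsoid n K := by
  have hfin : Module.finrank ℂ (EuclideanSpace ℂ (Fin n)) = n := finrank_euclideanSpace_fin
  have : Nontrivial (EuclideanSpace ℂ (Fin n)) :=
    Module.nontrivial_of_finrank_pos (R := ℂ) (by omega)
  obtain ⟨z₀, hz₀, hz₀0⟩ : (interior K ∩ {0}ᶜ).Nonempty :=
    have := Module.punctured_nhds_neBot ℂ _ (0 : EuclideanSpace ℂ (Fin n))
    (dense_compl_singleton 0).inter_open_nonempty _ isOpen_interior hint
  obtain ⟨ρ, hρ, hball⟩ := Metric.isOpen_iff.1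
    (isOpen_interior.inter isOpen_compl_singleton) z₀ ⟨hz₀, hz₀0⟩
  have hplane : ∀ u v : EuclideanSpace ℂ (Fin n), u ∈ interior K →
      ∃ (H : Submodule ℂ (EuclideanSpace ℂ (Fin n)))
        (A : EuclideanSpace ℂ (Fin n) →ₗ[ℂ] EuclideanSpace ℂ (Fin k))
        (l : EuclideanSpace ℂ (Fin n) →ₗ[ℂ] ℂ),
        u ∈ H ∧ v ∈ H ∧ IsHermitianSection K c lam H A l := by
    intro u v hu
    obtain ⟨H, hH, huH, hvH⟩ := exists_submodule_finrank_eq_mem hk (by omega) u v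
    obtain ⟨A, l, h⟩ := hsec H hH ⟨u, huH, hu⟩
    exact ⟨H, A, l, huH, hvH, h⟩
  choose Hc Ac lc hz₀H hmemH hsecH using fun h => hplane z₀ h hz₀
  obtain ⟨q, hq⟩ : ∃ q : EuclideanSpace ℂ (Fin n) → ℝ, ∀ h, q h = ‖Ac h h‖ ^ 2 :=
    ⟨_, fun _ => rfl⟩
  obtain ⟨L, hL⟩ : ∃ L : EuclideanSpace ℂ (Fin n) → ℂ, ∀ h, L h = lc h h := ⟨_, fun _ => rfl⟩
  have huniq : ∀ {H H' A A' l l'}, IsHermitianSection (k := k) K c lam H A l →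
      IsHermitianSection (k := k) K c lam H' A' l' → ∀ v ∈ Metric.ball z₀ ρ, v ∈ H → v ∈ H' →
      ‖A v‖ ^ 2 = ‖A' v‖ ^ 2 ∧ l v = l' v := by
    intro H H' A A' l l' hS hS' v hvb hv hv'
    exact hS.unique hS' hv hv' (interior_subset (hball hvb).1) (hball hvb).2
      fun hc => hlam hc v (hball hvb).1
  have hcons : ∀ {H A l}, IsHermitianSection (k := k) K c lam H A l →
      ∀ v ∈ Metric.ball z₀ ρ, v ∈ H → q v = ‖A v‖ ^ 2 ∧ L v = l v := by
    intro H A l hS v hvb hv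
    rw [hq, hL]
    exact huniq (hsecH v) hS v hvb (hmemH v) hv
  have hsmall : ∀ h : EuclideanSpace ℂ (Fin n), ∃ δ : ℝ, 0 < δ ∧ ∀ t : ℝ, |t| < δ →
      z₀ + (t : ℂ) • h ∈ Metric.ball z₀ ρ := by
    intro h
    have ev : ∀ᶠ t : ℝ in nhds 0, z₀ + (t : ℂ) • h ∈ Metric.ball z₀ ρ :=
      ContinuousAt.eventually_mem (f := fun t : ℝ => z₀ + (t : ℂ) • h) (by fun_prop)
        (Metric.isOpen_ball.mem_nhds (by simpa using hρ))
    obtain ⟨δ, hδ, hall⟩ := Metric.eventually_nhds_iff.1 ev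
    exact ⟨δ, hδ, fun t ht => hall (by simpa using ht)⟩
  have hz₀b : z₀ ∈ Metric.ball z₀ ρ := Metric.mem_ball_self hρ
  -- For planes through `z₀` agreement extends to all of `H`, even away from `K`: the values at `z₀`
  -- and `z₀ ± ε • h` determine those at `h`.
  have hcentral : ∀ {H A l}, IsHermitianSection (k := k) K c lam H A l → z₀ ∈ H → ∀ h ∈ H,
      q h = ‖A h‖ ^ 2 ∧ L h = l h := by
    intro H A l hS hz h hh
    obtain ⟨δ, hδ, hall⟩ := hsmall h
    obtain ⟨ε, hε, hεδ⟩ : ∃ ε : ℝ, 0 < ε ∧ ε < δ := exists_between hδ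
    have hεC : (ε : ℂ) ≠ 0 := by exact_mod_cast hε.ne'
    have m1 := hall ε (by rwa [abs_of_pos hε])
    have m2 := hall (-ε) (by rwa [abs_neg, abs_of_pos hε])
    rw [Complex.ofReal_neg, neg_smul, ← sub_eq_add_neg] at m2
    have u0 := huniq (hsecH h) hS z₀ hz₀b (hz₀H h) hz
    have u1 := huniq (hsecH h) hS _ m1 ((Hc h).add_mem (hz₀H h) ((Hc h).smul_mem _ (hmemH h)))
      (H.add_mem hz (H.smul_mem _ hh))
    have u2 := huniq (hsecH h) hS _ m2 ((Hc h).sub_mem (hz₀H h) ((Hc h).smul_mem _ (hmemH h)))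
      (H.sub_mem hz (H.smul_mem _ hh))
    constructor
    · have p1 := parallelogram_law_with_norm ℂ (A z₀) (A ((ε : ℂ) • h))
      have p2 := parallelogram_law_with_norm ℂ (Ac h z₀) (Ac h ((ε : ℂ) • h))
      have e1 := u1.1
      have e2 := u2.1
      rw [map_add, map_add] at e1
      rw [map_sub, map_sub] at e2
      rw [map_smul, norm_smul, Complex.norm_real, Real.norm_eq_abs, abs_of_pos hε] at p1 p2
      rw [map_smul, map_smul] at e1 e2
      have e0 := u0.1
      have : ε ^ 2 * ‖Ac h h‖ ^ 2 = ε ^ 2 * ‖A h‖ ^ 2 := by nlinarith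
      rw [hq]
      exact mul_left_cancel₀ (by positivity) this
    · have e1 := u1.2
      rw [map_add, map_add, u0.2, add_right_inj, map_smul, map_smul, smul_eq_mul,
        smul_eq_mul] at e1
      rw [hL]
      exact mul_left_cancel₀ hεC e1
  have hLadd₀ : ∀ (ζ : ℂ) h, L (z₀ + ζ • h) = L z₀ + ζ * L h := by
    intro ζ h
    have hm := (Hc h).smul_mem ζ (hmemH h)
    rw [(hcentral (hsecH h) (hz₀H h) _ ((Hc h).add_mem (hz₀H h) hm)).2,
      (hcentral (hsecH h) (hz₀H h) _ (hz₀H h)).2, hL, map_add, map_smul, smul_eq_mul]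
  have hLsmul : ∀ (ζ : ℂ) h, L (ζ • h) = ζ * L h := by
    intro ζ h
    rw [(hcentral (hsecH h) (hz₀H h) _ ((Hc h).smul_mem ζ (hmemH h))).2, hL, map_smul, smul_eq_mul]
  have hLadd : ∀ h h', L (h + h') = L h + L h' := by
    intro h h'
    obtain ⟨δ, hδ, hall⟩ := hsmall h
    obtain ⟨δ', hδ', hall'⟩ := hsmall h'
    obtain ⟨ε, hε, hεδ⟩ : ∃ ε : ℝ, 0 < ε ∧ ε < min δ δ' := exists_between (lt_min hδ hδ')
    have hεC : (ε : ℂ) ≠ 0 := by exact_mod_cast hε.ne'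
    have m1 := hall ε (by rw [abs_of_pos hε]; exact hεδ.trans_le (min_le_left _ _))
    have m2 := hall' ε (by rw [abs_of_pos hε]; exact hεδ.trans_le (min_le_right _ _))
    -- This plane need not contain `z₀`, but it contains the midpoint of the two points, and
    -- linearity of `l` there gives additivity of `L`.
    obtain ⟨H, A, l, h1, h2, hS⟩ := hplane _ (z₀ + (ε : ℂ) • h') (hball m1).1
    have e3 : z₀ + ((ε / 2 : ℝ) : ℂ) • (h + h') =
        (1 / 2 : ℂ) • ((z₀ + (ε : ℂ) • h) + (z₀ + (ε : ℂ) • h')) := by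
      push_cast
      module
    have m3 : z₀ + ((ε / 2 : ℝ) : ℂ) • (h + h') ∈ Metric.ball z₀ ρ := by
      rw [mem_ball_iff_norm, add_sub_cancel_left] at m1 m2 ⊢
      have e4 : ((ε / 2 : ℝ) : ℂ) • (h + h') = (1 / 2 : ℂ) • ((ε : ℂ) • h + (ε : ℂ) • h') := by
        push_cast
        module
      have e5 := norm_add_le ((ε : ℂ) • h) ((ε : ℂ) • h')
      have e6 : ‖(1 / 2 : ℂ)‖ = 1 / 2 := by norm_num
      rw [e4, norm_smul, e6]
      linarith
    have h3 : z₀ + ((ε / 2 : ℝ) : ℂ) • (h + h') ∈ H := by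
      rw [e3]
      exact H.smul_mem _ (H.add_mem h1 h2)
    have l1 := (hcons hS _ m1 h1).2
    have l2 := (hcons hS _ m2 h2).2
    have l3 := (hcons hS _ m3 h3).2
    rw [hLadd₀, e3, map_smul, map_add, ← l1, ← l2, hLadd₀, hLadd₀, smul_eq_mul] at l3
    push_cast at l3
    refine mul_left_cancel₀ hεC ?_
    linear_combination 2 * l3
  have hhom : ∀ (ζ : ℂ) h, q (ζ • h) = ‖ζ‖ ^ 2 * q h := by
    intro ζ h
    rw [(hcentral (hsecH h) (hz₀H h) _ ((Hc h).smul_mem ζ (hmemH h))).1, hq, map_smul, norm_smul,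
      mul_pow]
  have hpos : ∀ h, h ≠ 0 → 0 < q h := by
    intro h hh
    rw [hq]
    exact pow_pos (norm_pos_iff.2 fun h0 => hh ((hsecH h).1 h (hmemH h) h0)) 2
  obtain ⟨hpar, hquad⟩ := parallelogram_of_quadratic_on_ball (q := q) (z₀ := z₀) hρ
    (fun t h => by
      rw [RCLike.real_smul_eq_coe_smul (K := ℂ), hhom]
      simp)
    (fun v hv w => by
      obtain ⟨H, A, l, hvH, hwH, hS⟩ := hplane v w (hball hv).1
      refine ⟨‖A v‖ ^ 2, 2 * (inner ℂ (A v) (A w)).re, ‖A w‖ ^ 2, fun t ht => ?_⟩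
      rw [RCLike.real_smul_eq_coe_smul (K := ℂ)] at ht ⊢
      rw [(hcons hS _ ht (H.add_mem hvH (H.smul_mem _ hwH))).1, map_add, map_smul,
        @norm_add_sq ℂ, inner_smul_right, norm_smul, mul_pow]
      simp
      ring)
    (fun h hh => by
      have m1 : z₀ + h ∈ Hc h := (Hc h).add_mem (hz₀H h) (hmemH h)
      have m2 : z₀ - h ∈ Hc h := (Hc h).sub_mem (hz₀H h) (hmemH h)
      rw [(hcentral (hsecH h) (hz₀H h) _ m1).1, (hcentral (hsecH h) (hz₀H h) _ m2).1,
        (hcentral (hsecH h) (hz₀H h) _ (hz₀H h)).1, hq, map_add, map_sub]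
      have := parallelogram_law_with_norm ℂ (Ac h z₀) (Ac h h)
      linarith)
  have hequiv := exists_linearEquiv_norm_sq hhom hpos hpar fun x y => by
    obtain ⟨a, b, c, h⟩ := hquad x y
    exact ⟨a, b, c, fun t ht => by
      have := h t ht
      rwa [RCLike.real_smul_eq_coe_smul (K := ℂ)] at this⟩
  rw [hfin] at hequiv
  obtain ⟨e, he⟩ := hequiv
  refine isComplexEllipsoid_of_forall_mem_iff (q := q) (c := c)
    (l := { toFun := L, map_add' := hLadd, map_smul' := fun ζ h => hLsmul ζ h }) e he ?_ ?_
  · exact (infinite_of_mem_nhds z₀ (mem_interior_iff_mem_nhds.1 hz₀)).nontrivial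
  · intro z
    change z ∈ K ↔ q z - 2 * (L z).re + c ≤ 0
    rw [hq, hL]
    exact (hsecH z).2.1 z (hmemH z)

/-! ### Translation to the origin and conclusion -/

theorem IsComplexEllipsoid.preimage_add_right {n m : ℕ} {S : Set (EuclideanSpace ℂ (Fin n))}
    (hS : IsComplexEllipsoid m S) (p : EuclideanSpace ℂ (Fin n)) :
    IsComplexEllipsoid m ((fun z => z + p) ⁻¹' S) := by
  obtain ⟨f, hf, rfl⟩ := hS
  refine ⟨f - AffineMap.const ℂ _ p, fun x y hxy => hf (by simpa using hxy), ?_⟩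
  ext z
  simp [sub_eq_iff_eq_add]

theorem mainTheorem5 (k n : ℕ) (hk : 2 ≤ k) (hkn : k < n)
    (K : ConvexBody (EuclideanSpace ℂ (Fin n)))
    (hK : (interior (K : Set (EuclideanSpace ℂ (Fin n)))).Nonempty)
    (p₀ : EuclideanSpace ℂ (Fin n))
    (hsec : ∀ H : AffineSubspace ℂ (EuclideanSpace ℂ (Fin n)),
      p₀ ∈ H → Module.finrank ℂ H.direction = k →
      ((H : Set (EuclideanSpace ℂ (Fin n))) ∩
        interior (K : Set (EuclideanSpace ℂ (Fin n)))).Nonempty →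
      IsComplexEllipsoid k
        ((H : Set (EuclideanSpace ℂ (Fin n))) ∩ (K : Set (EuclideanSpace ℂ (Fin n))))) :
    IsComplexEllipsoid n (K : Set (EuclideanSpace ℂ (Fin n))) := by
  set K' : Set (EuclideanSpace ℂ (Fin n)) := (fun z => z + p₀) ⁻¹' K with hK'
  have hint : interior K' = (fun z => z + p₀) ⁻¹' interior (K : Set (EuclideanSpace ℂ (Fin n))) :=
    ((Homeomorph.addRight p₀).preimage_interior _).symm
  have hint' : (interior K').Nonempty := by
    obtain ⟨z, hz⟩ := hK
    exact ⟨z - p₀, by rw [hint]; simpa using hz⟩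
  have hconv : Convex ℝ K' := K.convex.translate_preimage_left p₀
  have hsec' : ∀ H : Submodule ℂ (EuclideanSpace ℂ (Fin n)), Module.finrank ℂ H = k →
      ((H : Set (EuclideanSpace ℂ (Fin n))) ∩ interior K').Nonempty →
      IsComplexEllipsoid k ((H : Set (EuclideanSpace ℂ (Fin n))) ∩ K') := by
    intro H hH hHK
    have hmem : ∀ z, z + p₀ ∈ AffineSubspace.mk' p₀ H ↔ z ∈ H := fun z => by
      rw [AffineSubspace.mem_mk', vsub_eq_sub, add_sub_cancel_right]
    have h := (hsec (AffineSubspace.mk' p₀ H) (AffineSubspace.self_mem_mk' _ _)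
      (by rw [AffineSubspace.direction_mk', hH]) (by
        obtain ⟨z, hz, hzK⟩ := hHK
        rw [hint] at hzK
        exact ⟨z + p₀, (hmem z).2 hz, hzK⟩)).preimage_add_right p₀
    convert h using 1
    ext z
    exact and_congr (hmem z).symm Iff.rfl
  obtain ⟨c, lam, hlam, hex⟩ := exists_isHermitianSection hk hconv hint' hsec'
  have h := (isComplexEllipsoid_of_isHermitianSection hk hkn hint' hlam hex).preimage_add_right
    (-p₀)
  convert h using 1
  ext z
  simp [hK']
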